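/- Fix a countably infinite set $\mathsf{Var}$ of propositional variables. For a symbol $\blacksquare\in\{\Box,[d]\}$ let $\mathcal L^\forall_{\blacksquare}$ be the set of formulas built from the variables $p\in\mathsf{Var}$ and $\top$ by $\neg$, $\wedge$, $\blacksquare$ and $\forall$. Write $\varphi\to\psi$ for $\neg(\varphi\wedge\neg\psi)$, $\bot$ for $\neg\top$, $\blacklozenge\varphi$ for $\neg\blacksquare\neg\varphi$ and $\exists\varphi$ for $\neg\forall\neg\varphi$. **Semantics.** Given a topological space $X$ and an assignment $h:\mathsf{Var}\to\wp(X)$, truth of a formula at a point $x\in X$ is defined by: $p$ is true at $x$ iff $x\in h(p)$; $\top$, $\neg$, $\wedge$ are interpreted as usual; $\Box\varphi$ (respectively $[d]\varphi$) is true at $x$ iff there is an open set $O\ni x$ such that $\varphi$ is true at every $y\in O$ (respectively every $y\in O\setminus\{x\}$); $\forall\varphi$ is true at $x$ iff $\varphi$ is true at every point of $X$. A set of formulas is satisfiable in $X$ if, for some assignment $h$, all its members are true at one common point of $X$. Write $\Sigma\models_X\varphi$ if $\Sigma\cup\{\neg\varphi\}$ is not satisfiable in $X$. **Deductive systems.**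 The axioms of S4U, in the language $\mathcal L^\forall_{\Box}$, are all propositional tautologies (of the modal language) and, for all formulas $\varphi,\psi$ of the language, $$\Box(\varphi\to\psi)\to(\Box\varphi\to\Box\psi),\quad \forall(\varphi\to\psi)\to(\forall\varphi\to\forall\psi),\quad \Box\varphi\to\varphi,\quad \Box\varphi\to\Box\Box\varphi,$$ $$\forall\varphi\to\varphi,\quad \varphi\to\forall\exists\varphi,\quad \forall\varphi\to\forall\forall\varphi,\quad \forall\varphi\to\Box\varphi .$$ Its rules are modus ponens and universal generalisation (from $\varphi$ infer $\forall\varphi$). The system KD4U, in the language $\mathcal L^\forall_{[d]}$, is obtained by writing $[d]$ for $\Box$ throughout and replacing the axioms $\Box\varphi\to\varphi$ by the single axiom $\langle d\rangle\top$, where $\langle d\rangle\varphi=\neg[d]\neg\varphi$. For either system write $\vdash\varphi$ if $\varphi$ is a theorem, and $\Sigma\vdash\varphi$ if $\vdash(\bigwedge\Sigma_0)\to\varphi$ for some finite $\Sigma_0\subseteq\Sigma$ (with $\bigwedge\emptyset=\top$). The system is *sound* over $X$ if $\vdash\varphi$ implies $\emptyset\models_X\varphi$ for every formula $\varphi$ of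 its language, and *strongly complete* over $X$ if $\Sigma\models_X\varphi$ implies $\Sigma\vdash\varphi$ for every (possibly infinite) set $\Sigma\cup\{\varphi\}$ of formulas of its language. **Statement.** Let $X$ be a metric space that is not compact, is $0$-dimensional (i.e. T1 with a base consisting of clopen sets) and is dense in itself (i.e. no singleton subset is open). Then 1. in the language $\mathcal L^\forall_{[d]}$, the system KD4U is sound and strongly complete over $X$; 2. in the language $\mathcal L^\forall_{\Box}$, the system S4U is sound and strongly complete over $X$. -/

import Mathlib

namespace TopModal

/-- The two local modalities: `interior` is written `□`, `coderivative` is written `[d]`. -/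
inductive LocalModality where
  | interior
  | coderivative

/-- Formulas with one local modality `m` and the universal modality `∀`, over the propositional
variables `Var`. `Formula .interior Var` is the language with `□` and `∀`, and
`Formula .coderivative Var` is the language with `[d]` and `∀`. -/
inductive Formula (m : LocalModality) (Var : Type*) where
  | var : Var → Formula m Var
  | top : Formula m Var
  | neg : Formula m Var → Formula m Var
  | and : Formula m Var → Formula m Var → Formula m Var
  /-- the local modality (`□` or `[d]`) -/
  | box : Formula m Var → Formula m Var
  /-- the universal modality `∀` -/
  | all : Formula m Var → Formula m Var

namespace Formula

variable {m : LocalModality} {Var : Type*}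

/-- `φ → ψ` abbreviates `¬(φ ∧ ¬ψ)`. -/
def imp (φ ψ : Formula m Var) : Formula m Var := .neg (.and φ (.neg ψ))

/-- `◇φ` (or `⟨d⟩φ`) abbreviates `¬□¬φ` (or `¬[d]¬φ`). -/
def dia (φ : Formula m Var) : Formula m Var := .neg (.box (.neg φ))

/-- `∃φ` abbreviates `¬∀¬φ`. -/
def ex (φ : Formula m Var) : Formula m Var := .neg (.all (.neg φ))

/-- The conjunction of finitely many formulas; the empty conjunction is `⊤`. -/
def conj : List (Formula m Var) → Formula m Var
  | [] => .top
  | [φ] => φ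
  | φ :: ψ :: l => .and φ (conj (ψ :: l))

/-- Propositional evaluation: `v` gives truth values to the variables and to the formulas that
start with a modality, which are all treated as propositional letters. -/
def propEval (v : Formula m Var → Prop) : Formula m Var → Prop
  | .var p => v (.var p)
  | .top => True
  | .neg φ => ¬ propEval v φ
  | .and φ ψ => propEval v φ ∧ propEval v ψ
  | .box φ => v (.box φ)
  | .all φ => v (.all φ)

/-- Propositional tautologies of the modal language. -/
def IsTautology (φ : Formula m Var) : Prop := ∀ v : Formula m Var → Prop, propEval v φ

end Formula

/-- The theorems of the system S4U, in the language with `□` and `∀`. -/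
inductive S4U {Var : Type*} : Formula .interior Var → Prop where
  | taut {φ : Formula .interior Var} : φ.IsTautology → S4U φ
  | box_K (φ ψ : Formula .interior Var) : S4U (((φ.imp ψ).box).imp (φ.box.imp ψ.box))
  | all_K (φ ψ : Formula .interior Var) : S4U (((φ.imp ψ).all).imp (φ.all.imp ψ.all))
  | box_T (φ : Formula .interior Var) : S4U (φ.box.imp φ)
  | box_4 (φ : Formula .interior Var) : S4U (φ.box.imp φ.box.box)
  | all_T (φ : Formula .interior Var) : S4U (φ.all.imp φ)
  | all_B (φ : Formula .interior Var) : S4U (φ.imp φ.ex.all)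
  | all_4 (φ : Formula .interior Var) : S4U (φ.all.imp φ.all.all)
  | all_box (φ : Formula .interior Var) : S4U (φ.all.imp φ.box)
  | modus_ponens {φ ψ : Formula .interior Var} : S4U (φ.imp ψ) → S4U φ → S4U ψ
  | univ_gen {φ : Formula .interior Var} : S4U φ → S4U φ.all

/-- The theorems of the system KD4U, in the language with `[d]` and `∀`. -/
inductive KD4U {Var : Type*} : Formula .coderivative Var → Prop where
  | taut {φ : Formula .coderivative Var} : φ.IsTautology → KD4U φ
  | box_K (φ ψ : Formula .coderivative Var) : KD4U (((φ.imp ψ).box).imp (φ.box.imp ψ.box))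
  | all_K (φ ψ : Formula .coderivative Var) : KD4U (((φ.imp ψ).all).imp (φ.all.imp ψ.all))
  | box_D : KD4U (Formula.top.dia)
  | box_4 (φ : Formula .coderivative Var) : KD4U (φ.box.imp φ.box.box)
  | all_T (φ : Formula .coderivative Var) : KD4U (φ.all.imp φ)
  | all_B (φ : Formula .coderivative Var) : KD4U (φ.imp φ.ex.all)
  | all_4 (φ : Formula .coderivative Var) : KD4U (φ.all.imp φ.all.all)
  | all_box (φ : Formula .coderivative Var) : KD4U (φ.all.imp φ.box)
  | modus_ponens {φ ψ : Formula .coderivative Var} : KD4U (φ.imp ψ) → KD4U φ → KD4U ψ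
  | univ_gen {φ : Formula .coderivative Var} : KD4U φ → KD4U φ.all

section Semantics

variable {m : LocalModality} {Var : Type*}

/-- The points of a neighbourhood `O` of `x` that the local modality quantifies over: all of `O`
for `□`, and `O \ {x}` for `[d]`. -/
def LocalModality.scope {X : Type*} (m : LocalModality) (O : Set X) (x : X) : Set X :=
  match m with
  | .interior => O
  | .coderivative => O \ {x}

/-- `Sat h x φ`: the formula `φ` is true at the point `x` of the topological model `(X, h)`. -/
def Sat {X : Type*} [TopologicalSpace X] (h : Var → Set X) : X → Formula m Var → Prop
  | x, .var p => x ∈ h p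
  | _, .top => True
  | x, .neg φ => ¬ Sat h x φ
  | x, .and φ ψ => Sat h x φ ∧ Sat h x ψ
  | x, .box φ => ∃ O : Set X, IsOpen O ∧ x ∈ O ∧ ∀ y ∈ m.scope O x, Sat h y φ
  | _, .all φ => ∀ y : X, Sat h y φ

/-- `Γ` is satisfiable in the space `X`: for some assignment `h` into `X`, all formulas of `Γ`
are true at one point of `(X, h)`. -/
def Satisfiable (X : Type*) [TopologicalSpace X] (Γ : Set (Formula m Var)) : Prop :=
  ∃ (h : Var → Set X) (x : X), ∀ γ ∈ Γ, Sat h x γ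

/-- `Γ ⊨_X φ`: the set `Γ ∪ {¬φ}` is not satisfiable in `X`. -/
def Entails (X : Type*) [TopologicalSpace X] (Γ : Set (Formula m Var)) (φ : Formula m Var) :
    Prop :=
  ¬ Satisfiable X (Γ ∪ {φ.neg})

/-- `Γ ⊢ φ`, for the deductive system whose theorems are given by `Thm`: some conjunction of
finitely many members of `Γ` provably implies `φ`. -/
def Proves (Thm : Formula m Var → Prop) (Γ : Set (Formula m Var)) (φ : Formula m Var) : Prop :=
  ∃ l : List (Formula m Var), (∀ ψ ∈ l, ψ ∈ Γ) ∧ Thm ((Formula.conj l).imp φ)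

/-- The deductive system with theorems `Thm` is sound over `X`. -/
def SoundOver (Thm : Formula m Var → Prop) (X : Type*) [TopologicalSpace X] : Prop :=
  ∀ φ : Formula m Var, Thm φ → Entails X ∅ φ

/-- The deductive system with theorems `Thm` is strongly complete over `X`. -/
def StronglyCompleteOver (Thm : Formula m Var → Prop) (X : Type*) [TopologicalSpace X] : Prop :=
  ∀ (Γ : Set (Formula m Var)) (φ : Formula m Var), Entails X Γ φ → Proves Thm Γ φ

end Semantics

/-- A space is dense in itself if no singleton is open. -/
def DenseInItself (X : Type*) [TopologicalSpace X] : Prop :=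
  ∀ x : X, ¬ IsOpen ({x} : Set X)

/-- A space is 0-dimensional if it is T1 and has a base consisting of clopen sets. -/
def ZeroDimensional (X : Type*) [TopologicalSpace X] : Prop :=
  T1Space X ∧ ∃ B : Set (Set X), TopologicalSpace.IsTopologicalBasis B ∧ ∀ s ∈ B, IsClopen s

end TopModal

/-! Completeness labels the points of X by maximal consistent sets ("worlds") so that every point
satisfies exactly the formulas in its label. The worlds form a transitive serial frame in which
chains have limits (`World.exists_limit`); S4U and KD4U are treated together through `IsLogic`.

The labelling (`exists_labelling`) is built in stages. A clopen cell labelled `w` receives a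
discrete, `1/(n+1)`-dense set of points whose label becomes `w` for good. The rest of the cell
splits into smaller clopen cells labelled by successors of `w`, and all witnesses for `◇φ ∈ w` recur
in cells shrinking to each chosen point (`exists_cells`). A point that is never chosen sees a chain
of labels and takes its limit. Such a point is approached by chosen points carrying labels from the
chain, and the limit contains `□φ` only if the chain already does, so the truth lemma holds there
too.

For `∀`, countably many worlds must be realised in one model. Noncompactness splits X into
infinitely many clopen pieces (`exists_clopen_partition`), one starting label for each. All labels
then agree on formulas `∀φ`. -/

namespace TopModal

open Formula

variable {m : LocalModality} {Var : Type*}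

/-! ### Countability of the language and propositional evaluation -/

namespace Formula

/-- An injective numbering of formulas, from a numbering of the variables. -/
def code (e : Var → ℕ) : Formula m Var → ℕ
  | .var p => 6 * e p
  | .top => 1
  | .neg φ => 6 * code e φ + 2
  | .and φ ψ => 6 * Nat.pair (code e φ) (code e ψ) + 3
  | .box φ => 6 * code e φ + 4
  | .all φ => 6 * code e φ + 5

/-- The residue of the code modulo 6 identifies the outermost constructor. -/
theorem code_injective {e : Var → ℕ} (he : Function.Injective e) :
    Function.Injective (code (m := m) e) := by
  intro φ
  induction φ with
  | var p =>
    intro ψ h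
    cases ψ <;> simp only [code] at h <;> first | omega | skip
    exact congrArg var (he (by omega))
  | top => intro ψ h; cases ψ <;> simp only [code] at h <;> first | omega | rfl
  | neg φ ih =>
    intro ψ h
    cases ψ <;> simp only [code] at h <;> first | omega | skip
    exact congrArg Formula.neg (ih (by omega))
  | and φ χ ih₁ ih₂ =>
    intro ψ h
    cases ψ <;> simp only [code] at h <;> first | omega | skip
    obtain ⟨h₁, h₂⟩ := Nat.pair_eq_pair.1 
      (Nat.eq_of_mul_eq_mul_left (by norm_num : 0 < 6) (Nat.add_right_cancel h))
    exact congrArg₂ Formula.and (ih₁ h₁) (ih₂ h₂)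
  | box φ ih =>
    intro ψ h
    cases ψ <;> simp only [code] at h <;> first | omega | skip
    exact congrArg Formula.box (ih (by omega))
  | all φ ih =>
    intro ψ h
    cases ψ <;> simp only [code] at h <;> first | omega | skip
    exact congrArg Formula.all (ih (by omega))

instance [Countable Var] : Countable (Formula m Var) :=
  let ⟨_, he⟩ := exists_injective_nat Var
  (code_injective he).countable

theorem propEval_imp (v : Formula m Var → Prop) (φ ψ : Formula m Var) :
    propEval v (φ.imp ψ) ↔ (propEval v φ → propEval v ψ) := by
  simp [imp, propEval]

theorem propEval_conj (v : Formula m Var → Prop) (l : List (Formula m Var)) :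
    propEval v (conj l) ↔ ∀ ψ ∈ l, propEval v ψ := by
  match l with
  | [] => simp [conj, propEval]
  | [φ] => simp [conj]
  | φ :: ψ :: l =>
    have := propEval_conj v (ψ :: l)
    rw [List.forall_mem_cons, ← this]
    simp [conj, propEval]

end Formula

/-! ### Derivability and Lindenbaum's lemma -/

/-- The common properties of the sets of theorems of S4U and KD4U. -/
structure IsLogic (L : Formula m Var → Prop) : Prop where
  taut {φ : Formula m Var} : φ.IsTautology → L φ
  box_K (φ ψ : Formula m Var) : L (((φ.imp ψ).box).imp (φ.box.imp ψ.box))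
  all_K (φ ψ : Formula m Var) : L (((φ.imp ψ).all).imp (φ.all.imp ψ.all))
  box_T (φ : Formula m Var) : m = .interior → L (φ.box.imp φ)
  box_D : L (Formula.top.dia)
  box_4 (φ : Formula m Var) : L (φ.box.imp φ.box.box)
  all_T (φ : Formula m Var) : L (φ.all.imp φ)
  all_B (φ : Formula m Var) : L (φ.imp φ.ex.all)
  all_4 (φ : Formula m Var) : L (φ.all.imp φ.all.all)
  all_box (φ : Formula m Var) : L (φ.all.imp φ.box)
  modus_ponens {φ ψ : Formula m Var} : L (φ.imp ψ) → L φ → L ψ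
  univ_gen {φ : Formula m Var} : L φ → L φ.all

theorem KD4U.isLogic : IsLogic (KD4U (Var := Var)) where
  taut := .taut
  box_K := .box_K
  all_K := .all_K
  box_T _ h := nomatch h
  box_D := .box_D
  box_4 := .box_4
  all_T := .all_T
  all_B := .all_B
  all_4 := .all_4
  all_box := .all_box
  modus_ponens := .modus_ponens
  univ_gen := .univ_gen

theorem S4U.isLogic : IsLogic (S4U (Var := Var)) where
  taut := .taut
  box_K := .box_K
  all_K := .all_K
  box_T φ _ := .box_T φ
  -- Seriality is reflexivity applied to `⊥`.
  box_D := by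
    refine .modus_ponens (.taut ?_) (.box_T Formula.top.neg)
    intro v
    simp [propEval_imp, propEval, dia]
  box_4 := .box_4
  all_T := .all_T
  all_B := .all_B
  all_4 := .all_4
  all_box := .all_box
  modus_ponens := .modus_ponens
  univ_gen := .univ_gen

/-- `Γ` is consistent if it does not prove `⊥`. -/
def Consistent (L : Formula m Var → Prop) (Γ : Set (Formula m Var)) : Prop :=
  ¬ Proves L Γ Formula.top.neg

/-- The maximal consistent sets of `L`. -/
structure World (L : Formula m Var → Prop) where
  carrier : Set (Formula m Var)
  consistent : Consistent L carrier
  complete (φ : Formula m Var) : φ ∈ carrier ∨ φ.neg ∈ carrier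

namespace IsLogic

variable {L : Formula m Var → Prop} {Γ : Set (Formula m Var)}

theorem tautConseq (hL : IsLogic L) (l : List (Formula m Var)) {φ : Formula m Var}
    (h : ∀ ψ ∈ l, L ψ) (hv : ∀ v, (∀ ψ ∈ l, propEval v ψ) → propEval v φ) : L φ := by
  induction l generalizing φ with
  | nil => exact hL.taut fun v => hv v (by simp)
  | cons ψ l ih =>
    refine hL.modus_ponens (ih (fun χ hχ => h χ (by simp [hχ])) fun v hl => ?_) (h ψ (by simp))
    rw [propEval_imp]
    intro hψ
    exact hv v (by simpa using ⟨hψ, hl⟩)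

theorem proves_modusPonens (hL : IsLogic L) {φ ψ : Formula m Var}
    (h₁ : Proves L Γ (φ.imp ψ)) (h₂ : Proves L Γ φ) : Proves L Γ ψ := by
  obtain ⟨l₁, hl₁, h₁⟩ := h₁
  obtain ⟨l₂, hl₂, h₂⟩ := h₂
  refine ⟨l₁ ++ l₂, ?_, hL.tautConseq [_, _] (by simpa using ⟨h₁, h₂⟩) fun v => ?_⟩
  · intro χ hχ
    rcases List.mem_append.1 hχ with h | h
    exacts [hl₁ χ h, hl₂ χ h]
  · simp only [List.mem_cons, List.not_mem_nil, or_false, forall_eq_or_imp, forall_eq,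
      propEval_imp, propEval_conj, List.mem_append]
    intro ⟨a, b⟩ c
    exact a (fun χ hχ => c χ (.inl hχ)) (b fun χ hχ => c χ (.inr hχ))

theorem proves_of_thm (hL : IsLogic L) {φ : Formula m Var} (h : L φ) : Proves L Γ φ :=
  ⟨[], by simp, hL.tautConseq [φ] (by simpa using h) fun v hv => by
    simp only [propEval_imp]; exact fun _ => hv φ (by simp)⟩

theorem proves_of_mem (hL : IsLogic L) {φ : Formula m Var} (h : φ ∈ Γ) : Proves L Γ φ :=
  ⟨[φ], by simpa using h, hL.taut fun v => by simp [propEval_imp, conj]⟩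

theorem proves_tautConseq (hL : IsLogic L) (l : List (Formula m Var)) {φ : Formula m Var}
    (h : ∀ ψ ∈ l, Proves L Γ ψ) (hv : ∀ v, (∀ ψ ∈ l, propEval v ψ) → propEval v φ) :
    Proves L Γ φ := by
  induction l generalizing φ with
  | nil => exact hL.proves_of_thm (hL.taut fun v => hv v (by simp))
  | cons ψ l ih =>
    refine hL.proves_modusPonens (ih (fun χ hχ => h χ (by simp [hχ])) fun v hl => ?_)
      (h ψ (by simp))
    rw [propEval_imp]
    intro hψ
    exact hv v (by simpa using ⟨hψ, hl⟩)

theorem proves_deduction (hL : IsLogic L) {φ ψ : Formula m Var}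
    (h : Proves L (insert φ Γ) ψ) : Proves L Γ (φ.imp ψ) := by
  classical
  obtain ⟨l, hl, h⟩ := h
  refine ⟨l.filter (· ≠ φ), ?_, hL.tautConseq [_] (by simpa using h) fun v => ?_⟩
  · intro χ hχ
    simp only [ne_eq, decide_not, List.mem_filter, Bool.not_eq_eq_eq_not, Bool.not_true,
      decide_eq_false_iff_not] at hχ
    exact (hl χ hχ.1).resolve_left hχ.2
  · simp only [List.mem_cons, List.not_mem_nil, or_false, forall_eq, propEval_imp, propEval_conj]
    intro a b c
    refine a fun χ hχ => ?_
    by_cases e : χ = φ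
    · exact e ▸ c
    · exact b χ (by simp [hχ, e])

theorem consistent_insert_neg (hL : IsLogic L) {φ : Formula m Var} (h : ¬ Proves L Γ φ) :
    Consistent L (insert φ.neg Γ) := by
  intro h'
  refine h (hL.proves_tautConseq [_] (by simpa using hL.proves_deduction h') fun v => ?_)
  simp [propEval_imp, propEval]

/-- Lindenbaum's lemma by Zorn: a derivation uses finitely many premises, so unions of chains of
consistent sets are consistent. -/
theorem exists_world (hL : IsLogic L) (h : Consistent L Γ) : ∃ w : World L, Γ ⊆ w.carrier := by
  obtain ⟨M, hΓ, hM⟩ := zorn_subset_nonempty {Δ | Consistent L Δ} (by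
    intro c hc hchain hne
    refine ⟨⋃₀ c, ?_, fun s hs => Set.subset_sUnion_of_mem hs⟩
    rintro ⟨l, hl, hp⟩
    have : ∃ s ∈ c, ∀ ψ ∈ l, ψ ∈ s := by
      clear hp
      induction l with
      | nil => exact ⟨hne.some, hne.some_mem, by simp⟩
      | cons φ l ih =>
        obtain ⟨s, hs, hls⟩ := ih fun ψ hψ => hl ψ (by simp [hψ])
        obtain ⟨t, ht, hφ⟩ := hl φ (by simp)
        rcases hchain.total hs ht with hst | hst
        · exact ⟨t, ht, by simpa using ⟨hφ, fun ψ hψ => hst (hls ψ hψ)⟩⟩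
        · exact ⟨s, hs, by simpa using ⟨hst hφ, hls⟩⟩
    obtain ⟨s, hs, hls⟩ := this
    exact hc hs ⟨l, hls, hp⟩) Γ h
  refine ⟨⟨M, hM.prop, fun φ => ?_⟩, hΓ⟩
  by_cases hφ : Proves L M φ
  · left
    have : Consistent L (insert φ M) := fun h' =>
      hM.prop (hL.proves_modusPonens (hL.proves_deduction h') hφ)
    exact hM.le_of_ge this (Set.subset_insert _ _) (Set.mem_insert _ _)
  · right
    exact hM.le_of_ge (hL.consistent_insert_neg hφ) (Set.subset_insert _ _) (Set.mem_insert _ _)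

end IsLogic

/-! ### The canonical frame -/

namespace World

variable {L : Formula m Var → Prop}

instance : Membership (Formula m Var) (World L) := ⟨fun w φ => φ ∈ w.carrier⟩

theorem mem_of_proves (hL : IsLogic L) (w : World L) {φ : Formula m Var}
    (h : Proves L w.carrier φ) : φ ∈ w := by
  refine (w.complete φ).resolve_right fun h' => w.consistent ?_
  refine hL.proves_tautConseq [φ, φ.neg] (by simpa using ⟨h, hL.proves_of_mem h'⟩) fun v => ?_
  simp [propEval]

theorem mem_of_thm (hL : IsLogic L) (w : World L) {φ : Formula m Var} (h : L φ) : φ ∈ w :=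
  w.mem_of_proves hL (hL.proves_of_thm h)

theorem mem_neg (hL : IsLogic L) (w : World L) {φ : Formula m Var} : φ.neg ∈ w ↔ φ ∉ w := by
  refine ⟨fun h h' => w.consistent ?_, fun h => (w.complete φ).resolve_left h⟩
  refine hL.proves_tautConseq [φ, φ.neg]
    (by simpa using ⟨hL.proves_of_mem h', hL.proves_of_mem h⟩) fun v => ?_
  simp [propEval]

theorem mem_and (hL : IsLogic L) (w : World L) {φ ψ : Formula m Var} :
    φ.and ψ ∈ w ↔ φ ∈ w ∧ ψ ∈ w := by
  refine ⟨fun h => ⟨?_, ?_⟩, fun h => ?_⟩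
  · exact w.mem_of_proves hL (hL.proves_tautConseq [φ.and ψ]
      (by simpa using hL.proves_of_mem h) (by simp +contextual [propEval]))
  · exact w.mem_of_proves hL (hL.proves_tautConseq [φ.and ψ]
      (by simpa using hL.proves_of_mem h) (by simp +contextual [propEval]))
  · exact w.mem_of_proves hL (hL.proves_tautConseq [φ, ψ]
      (by simpa using ⟨hL.proves_of_mem h.1, hL.proves_of_mem h.2⟩)
      (by simp +contextual [propEval]))

theorem mem_imp (hL : IsLogic L) (w : World L) {φ ψ : Formula m Var} :
    φ.imp ψ ∈ w ↔ (φ ∈ w → ψ ∈ w) := by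
  simp [imp, mem_neg hL, mem_and hL]

theorem mem_top (hL : IsLogic L) (w : World L) : Formula.top ∈ w :=
  w.mem_of_thm hL (hL.taut fun v => by simp [propEval])

theorem mp (hL : IsLogic L) (w : World L) {φ ψ : Formula m Var} (h : L (φ.imp ψ))
    (hφ : φ ∈ w) : ψ ∈ w :=
  (w.mem_imp hL).1 (w.mem_of_thm hL h) hφ

end World

namespace IsLogic

variable {L : Formula m Var → Prop}

theorem box_gen (hL : IsLogic L) {φ : Formula m Var} (h : L φ) : L φ.box :=
  hL.modus_ponens (hL.all_box φ) (hL.univ_gen h)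

/-- The existence lemma for an arbitrary normal modality `op`. -/
theorem exists_world_of_notMem (hL : IsLogic L) (op : Formula m Var → Formula m Var)
    (hK : ∀ φ ψ, L ((op (φ.imp ψ)).imp ((op φ).imp (op ψ)))) (hN : ∀ φ, L φ → L (op φ))
    (w : World L) {φ : Formula m Var} (h : op φ ∉ w) :
    ∃ v : World L, (∀ ψ, op ψ ∈ w → ψ ∈ v) ∧ φ ∉ v := by
  -- Premises are discharged one at a time with K, so whatever follows from `{ψ | op ψ ∈ w}` has its
  -- `op` in `w`.
  have key : ∀ (l : List (Formula m Var)) (φ : Formula m Var), (∀ ψ ∈ l, op ψ ∈ w) →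
      L ((conj l).imp φ) → op φ ∈ w := by
    intro l
    induction l with
    | nil =>
      intro φ _ h
      refine w.mem_of_thm hL (hN _ (hL.tautConseq [_] (by simpa using h) fun v => ?_))
      simp [propEval_imp, propEval_conj]
    | cons ψ l ih =>
      intro φ hl h
      have h₁ : op (ψ.imp φ) ∈ w := by
        refine ih _ (fun χ hχ => hl χ (by simp [hχ]))
          (hL.tautConseq [_] (by simpa using h) fun v => ?_)
        simp only [List.mem_cons, List.not_mem_nil, or_false, forall_eq, propEval_imp,
          propEval_conj, forall_eq_or_imp]
        exact fun a b c => a ⟨c, b⟩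
      exact (w.mem_imp hL).1 (w.mp hL (hK _ _) h₁) (hl ψ (by simp))
  have hc : Consistent L (insert φ.neg {ψ | op ψ ∈ w}) :=
    hL.consistent_insert_neg fun ⟨l, hl, hp⟩ => h (key l φ hl hp)
  obtain ⟨v, hv⟩ := hL.exists_world hc
  exact ⟨v, fun ψ hψ => hv (Set.mem_insert_of_mem _ hψ),
    (v.mem_neg hL).1 (hv (Set.mem_insert _ _))⟩

theorem all_mono (hL : IsLogic L) {φ ψ : Formula m Var} (h : L (φ.imp ψ)) :
    L (φ.all.imp ψ.all) :=
  hL.modus_ponens (hL.all_K _ _) (hL.univ_gen h)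

/-- B gives `¬∀φ → ∀∃¬∀φ`, and 4 contraposed reduces `∃¬∀φ` to `¬∀φ`. This is what transfers
`∀`-formulas backwards in `sameAll_of_forall`. -/
theorem all_5 (hL : IsLogic L) (φ : Formula m Var) : L (φ.all.neg.imp φ.all.neg.all) := by
  have h₁ : L (φ.all.all.imp φ.all.neg.neg.all) :=
    hL.all_mono (hL.taut fun v => by simp [propEval_imp, propEval])
  have h₂ : L (φ.all.neg.ex.imp φ.all.neg) :=
    hL.tautConseq [_, _] (by simpa using ⟨hL.all_4 φ, h₁⟩) fun v => by
      simp only [List.mem_cons, List.not_mem_nil, or_false, forall_eq_or_imp, forall_eq,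
        propEval_imp, ex, propEval]
      tauto
  refine hL.tautConseq [_, _] (by simpa using ⟨hL.all_B φ.all.neg, hL.all_mono h₂⟩) fun v => ?_
  simp only [List.mem_cons, List.not_mem_nil, or_false, forall_eq_or_imp, forall_eq, propEval_imp]
  tauto

end IsLogic

namespace World

variable {L : Formula m Var → Prop}

/-- The canonical accessibility relation of the local modality. -/
def Rel (w v : World L) : Prop := ∀ φ : Formula m Var, φ.box ∈ w → φ ∈ v

/-- Two worlds contain the same formulas `∀φ`. -/
def SameAll (w v : World L) : Prop := ∀ φ : Formula m Var, φ.all ∈ w ↔ φ.all ∈ v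

theorem sameAll_of_forall (hL : IsLogic L) {w v : World L}
    (h : ∀ φ : Formula m Var, φ.all ∈ w → φ ∈ v) : SameAll w v := by
  refine fun φ => ⟨fun hφ => h _ (w.mp hL (hL.all_4 φ) hφ), fun hφ => ?_⟩
  by_contra h'
  exact (v.mem_neg hL).1 (h _ (w.mp hL (hL.all_5 φ) ((w.mem_neg hL).2 h'))) hφ

theorem Rel.sameAll (hL : IsLogic L) {w v : World L} (h : Rel w v) : SameAll w v :=
  sameAll_of_forall hL fun φ hφ => h φ (w.mp hL (hL.all_box φ) hφ)

theorem Rel.trans (hL : IsLogic L) {w v u : World L} (h₁ : Rel w v) (h₂ : Rel v u) :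
    Rel w u := fun φ hφ => h₂ φ (h₁ _ (w.mp hL (hL.box_4 φ) hφ))

theorem Rel.box_mem (hL : IsLogic L) {w v : World L} (h : Rel w v) {φ : Formula m Var}
    (hφ : φ.box ∈ w) : φ.box ∈ v := h _ (w.mp hL (hL.box_4 φ) hφ)

theorem exists_rel (hL : IsLogic L) (w : World L) {φ : Formula m Var} (h : φ.box ∉ w) :
    ∃ v : World L, Rel w v ∧ φ ∉ v :=
  hL.exists_world_of_notMem .box hL.box_K (fun _ => hL.box_gen) w h

theorem exists_sameAll (hL : IsLogic L) (w : World L) {φ : Formula m Var} (h : φ.all ∉ w) :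
    ∃ v : World L, SameAll w v ∧ φ ∉ v :=
  let ⟨v, hv, hφ⟩ := hL.exists_world_of_notMem .all hL.all_K (fun _ => hL.univ_gen) w h
  ⟨v, sameAll_of_forall hL hv, hφ⟩

theorem exists_rel_serial (hL : IsLogic L) (w : World L) : ∃ v : World L, Rel w v :=
  let ⟨v, hv, _⟩ := w.exists_rel hL ((w.mem_neg hL).1 (w.mem_of_thm hL hL.box_D))
  ⟨v, hv⟩

/-- A sequence of successors of `w` that contains, infinitely often, witnesses for every
`◇φ ∈ w`. -/
theorem exists_rel_seq [Countable Var] (hL : IsLogic L) (w : World L) :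
    ∃ g : ℕ → World L, (∀ n, Rel w (g n)) ∧
      ∀ φ : Formula m Var, φ.box ∉ w → ∀ N, ∃ n ≥ N, φ ∉ g n := by
  have : Nonempty (Formula m Var) := ⟨.top⟩
  obtain ⟨e, he⟩ := exists_surjective_nat (Formula m Var)
  -- The first component of `n` names the formula; the second is free, so each formula recurs
  -- infinitely often. Seriality fills the indices that need no witness.
  have : ∀ n : ℕ, ∃ v : World L, Rel w v ∧ ((e n.unpair.1).box ∉ w → e n.unpair.1 ∉ v) := by
    intro n
    by_cases h : (e n.unpair.1).box ∈ w
    · obtain ⟨v, hv⟩ := w.exists_rel_serial hL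
      exact ⟨v, hv, fun h' => absurd h h'⟩
    · obtain ⟨v, hv, hφ⟩ := w.exists_rel hL h
      exact ⟨v, hv, fun _ => hφ⟩
  choose g hg hg' using this
  refine ⟨g, hg, fun φ hφ N => ?_⟩
  obtain ⟨k, rfl⟩ := he φ
  refine ⟨Nat.pair k N, Nat.right_le_pair k N, ?_⟩
  have := hg' (Nat.pair k N)
  rw [Nat.unpair_pair] at this
  exact this hφ

/-- Every chain of worlds has a limit world. -/
theorem exists_limit (hL : IsLogic L) (w : ℕ → World L) (hw : ∀ n, Rel (w n) (w (n + 1))) :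
    ∃ u : World L, (∀ n, Rel (w n) u) ∧ ∀ φ : Formula m Var, φ.box ∈ u → ∃ n, φ.box ∈ w n := by
  have hlt : ∀ n k, n < k → Rel (w n) (w k) := fun n k h => by
    induction k, h using Nat.le_induction with
    | base => exact hw n
    | succ k _ ih => exact ih.trans hL (hw k)
  -- The second set keeps new boxes out of the limit. Any finite part of the union lies in all late
  -- enough `w n`.
  have hc : Consistent L ({φ | ∃ n, φ.box ∈ w n} ∪
      {ψ | ∃ φ : Formula m Var, ψ = φ.box.neg ∧ ∀ n, φ.box ∉ w n}) := by
    rintro ⟨l, hl, hp⟩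
    have : ∃ N, ∀ n ≥ N, ∀ ψ ∈ l, ψ ∈ w n := by
      clear hp
      induction l with
      | nil => exact ⟨0, by simp⟩
      | cons φ l ih =>
        obtain ⟨N, hN⟩ := ih fun ψ hψ => hl ψ (by simp [hψ])
        rcases hl φ (by simp) with ⟨k, hk⟩ | ⟨ψ, rfl, hψ⟩
        · refine ⟨max N (k + 1), fun n hn => ?_⟩
          simp only [List.mem_cons, forall_eq_or_imp]
          exact ⟨hlt k n (by omega) φ hk, hN n (by omega)⟩
        · refine ⟨N, fun n hn => ?_⟩
          simp only [List.mem_cons, forall_eq_or_imp]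
          exact ⟨((w n).mem_neg hL).2 (hψ n), hN n hn⟩
    obtain ⟨N, hN⟩ := this
    exact (w N).consistent ⟨l, hN N le_rfl, hp⟩
  obtain ⟨u, hu⟩ := hL.exists_world hc
  refine ⟨u, fun n φ hφ => hu (.inl ⟨n, hφ⟩), fun φ hφ => ?_⟩
  by_contra! h
  exact (u.mem_neg hL).1 (hu (.inr ⟨φ, rfl, h⟩)) hφ

end World

end TopModal

namespace TopModal

open Topology TopologicalSpace Set

/-! ### Clopen partitions of 0-dimensional metric spaces -/

section ZeroDimensional

variable {X : Type*} [MetricSpace X]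

theorem ZeroDimensional.exists_clopen_subset (hX : ZeroDimensional X) {x : X} {O : Set X}
    (hO : IsOpen O) (hx : x ∈ O) : ∃ V : Set X, IsClopen V ∧ x ∈ V ∧ V ⊆ O := by
  obtain ⟨-, B, hB, hcl⟩ := hX
  obtain ⟨V, hV, hxV, hVO⟩ := hB.exists_subset_of_mem_open hx hO
  exact ⟨V, hcl V hV, hxV, hVO⟩

theorem DenseInItself.exists_ne (hX : DenseInItself X) {x : X} {O : Set X} (hO : IsOpen O)
    (hx : x ∈ O) : ∃ y ∈ O, y ≠ x := by
  by_contra! h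
  have : O = {x} := Subset.antisymm (fun y hy => h y hy) (singleton_subset_iff.2 hx)
  exact hX x (this ▸ hO)

/-- Every point has a strictly decreasing base of clopen neighbourhoods. -/
theorem exists_strictAnti_clopen (hzero : ZeroDimensional X) (hdense : DenseInItself X)
    {x : X} {U : Set X} (hU : IsOpen U) (hx : x ∈ U) :
    ∃ V : ℕ → Set X, (∀ n, IsClopen (V n)) ∧ (∀ n, x ∈ V n) ∧ V 0 ⊆ U ∧ Antitone V ∧
      (∀ n, (V n \ V (n + 1)).Nonempty) ∧ ∀ O : Set X, IsOpen O → x ∈ O → ∃ n, V n ⊆ O := by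
  have step : ∀ (V : {V : Set X // IsClopen V ∧ x ∈ V}) (n : ℕ),
      ∃ V' : {V : Set X // IsClopen V ∧ x ∈ V}, V'.1 ⊆ V.1 ∧ (V.1 \ V'.1).Nonempty ∧
        V'.1 ⊆ Metric.ball x (1 / ((n : ℝ) + 1)) := by
    rintro ⟨V, hV, hxV⟩ n
    -- Discarding a second point `y` makes the decrease strict.
    obtain ⟨y, hy, hne⟩ := hdense.exists_ne hV.isOpen hxV
    obtain ⟨V', hV', hxV', hs⟩ := hzero.exists_clopen_subset
      (O := V ∩ Metric.ball x (1 / ((n : ℝ) + 1)) ∩ {y}ᶜ)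
      ((hV.isOpen.inter Metric.isOpen_ball).inter isOpen_compl_singleton)
      ⟨⟨hxV, Metric.mem_ball_self (by positivity)⟩, hne.symm⟩
    exact ⟨⟨V', hV', hxV'⟩, fun z hz => (hs hz).1.1, ⟨y, hy, fun h => (hs h).2 rfl⟩,
      fun z hz => (hs hz).1.2⟩
  choose nxt h₁ h₂ h₃ using step
  obtain ⟨V₀, hV₀, hxV₀, hs₀⟩ := hzero.exists_clopen_subset hU hx
  let V : ℕ → {V : Set X // IsClopen V ∧ x ∈ V} := fun n =>
    Nat.rec ⟨V₀, hV₀, hxV₀⟩ (fun n V => nxt V n) n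
  refine ⟨fun n => (V n).1, fun n => (V n).2.1, fun n => (V n).2.2, hs₀,
    antitone_nat_of_succ_le fun n => h₁ (V n) n, fun n => h₂ (V n) n, fun O hO hxO => ?_⟩
  obtain ⟨ε, hε, hb⟩ := Metric.isOpen_iff.1 hO x hxO
  obtain ⟨n, hn⟩ := exists_nat_one_div_lt hε
  exact ⟨n + 1, (h₃ (V n) n).trans ((Metric.ball_subset_ball hn.le).trans hb)⟩

/-- A point of `U` at distance at least `ε` from a maximal `ε`-separated set could be added to it.
-/
theorem exists_maximal_separated (U : Set X) {ε : ℝ} (hε : 0 < ε) :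
    ∃ B ⊆ U, (∀ b ∈ B, ∀ c ∈ B, dist b c < ε → b = c) ∧ ∀ x ∈ U, ∃ b ∈ B, dist x b < ε := by
  obtain ⟨B, -, hB⟩ := zorn_subset_nonempty
    {B : Set X | B ⊆ U ∧ ∀ b ∈ B, ∀ c ∈ B, dist b c < ε → b = c} (by
      intro c hc hchain _
      refine ⟨⋃₀ c, ⟨sUnion_subset fun s hs => (hc hs).1, ?_⟩,
        fun s hs => subset_sUnion_of_mem hs⟩
      rintro a ⟨s, hs, ha⟩ b ⟨t, ht, hb⟩
      rcases hchain.total hs ht with hst | hst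
      · exact (hc ht).2 a (hst ha) b hb
      · exact (hc hs).2 a ha b (hst hb)) ∅ (by simp)
  refine ⟨B, hB.prop.1, hB.prop.2, fun x hx => ?_⟩
  by_contra! h
  have hxB : x ∈ B := by
    refine hB.le_of_ge (y := insert x B) ⟨insert_subset hx hB.prop.1, ?_⟩ (subset_insert _ _)
      (mem_insert _ _)
    rintro a (rfl | ha) b (rfl | hb) hab
    · rfl
    · exact absurd hab (h b hb).not_gt
    · exact absurd (dist_comm a b ▸ hab) (h a ha).not_gt
    · exact hB.prop.2 a ha b hb hab
  exact absurd (h x hxB) (by simpa using hε)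

/-- The partition step: a clopen set `U` is split into a uniformly discrete `ε`-dense set `B` and
clopen cells `C y` with labels, such that the cells labelled `g k` converge to each point of `B`. -/
theorem exists_cells (hzero : ZeroDimensional X) (hdense : DenseInItself X) {W : Type*}
    (g : ℕ → W) {U : Set X} (hU : IsClopen U) {ε : ℝ} (hε : 0 < ε) :
    ∃ (B : Set X) (C : X → Set X) (lab : X → W), B ⊆ U ∧ (∀ x ∈ U, ∃ b ∈ B, dist x b < ε) ∧
      (∀ b ∈ B, ∃ O : Set X, IsOpen O ∧ b ∈ O ∧ O ∩ B ⊆ {b}) ∧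
      (∀ y ∈ U \ B, IsClopen (C y) ∧ y ∈ C y ∧ C y ⊆ U \ B ∧ (∃ n, lab y = g n) ∧
        ∀ z ∈ C y, C z = C y ∧ lab z = lab y) ∧
      ∀ b ∈ B, ∀ O : Set X, IsOpen O → b ∈ O →
        ∃ N, ∀ k ≥ N, ∃ y ∈ U \ B, C y ⊆ O ∧ lab y = g k := by
  classical
  obtain ⟨B, hBU, hsep, hdns⟩ := exists_maximal_separated U hε
  -- Since points of `B` are at least `ε` apart, radius `ε / 4` makes the neighbourhoods disjoint
  -- and lets every `ε / 4`-ball meet at most one of them.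
  have hV : ∀ b : B, ∃ V : ℕ → Set X, (∀ n, IsClopen (V n)) ∧ (∀ n, b.1 ∈ V n) ∧
      V 0 ⊆ U ∩ Metric.ball b.1 (ε / 4) ∧ Antitone V ∧
      (∀ n, (V n \ V (n + 1)).Nonempty) ∧ ∀ O : Set X, IsOpen O → b.1 ∈ O → ∃ n, V n ⊆ O :=
    fun b => exists_strictAnti_clopen hzero hdense (hU.isOpen.inter Metric.isOpen_ball)
      ⟨hBU b.2, Metric.mem_ball_self (by linarith)⟩
  choose V hVcl hbV hV0 hanti hne hbase using hV
  have hVb : ∀ b n y, y ∈ V b n → y ∈ U ∧ dist y b.1 < ε / 4 := fun b n y hy =>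
    hV0 b (hanti b (Nat.zero_le n) hy)
  have huniq : ∀ b c n k y, y ∈ V b n → y ∈ V c k → b = c := by
    intro b c n k y hb hc
    refine Subtype.ext (hsep _ b.2 _ c.2 ?_)
    have := dist_triangle_left b.1 c.1 y
    linarith [(hVb b n y hb).2, (hVb c k y hc).2]
  have hfin : LocallyFinite fun b => V b 0 := by
    intro x
    refine ⟨Metric.ball x (ε / 4), Metric.ball_mem_nhds x (by linarith), ?_⟩
    refine Set.Subsingleton.finite ?_
    rintro b ⟨y, hy, hyx⟩ c ⟨z, hz, hzx⟩
    refine Subtype.ext (hsep _ b.2 _ c.2 ?_)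
    have h₁ := dist_triangle_left b.1 x y
    have h₂ := dist_triangle_left c.1 x z
    have h₃ := dist_triangle_right b.1 c.1 x
    rw [Metric.mem_ball] at hyx hzx
    linarith [(hVb b 0 y hy).2, (hVb c 0 z hz).2]
  have hUnion : IsClopen (⋃ b, V b 0) :=
    ⟨hfin.isClosed_iUnion fun b => (hVcl b 0).isClosed, isOpen_iUnion fun b => (hVcl b 0).isOpen⟩
  -- The cells are the annuli around the points of `B`, with `none` for the remainder of `U`.
  let A : Option (B × ℕ) → Set X := fun i =>
    i.elim (U \ ⋃ b, V b 0) fun p => V p.1 p.2 \ V p.1 (p.2 + 1)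
  have hAcl : ∀ i, IsClopen (A i) := by
    rintro (_ | p)
    · exact hU.diff hUnion
    · exact (hVcl _ _).diff (hVcl _ _)
  have hAU : ∀ i, A i ⊆ U \ B := by
    rintro (_ | ⟨b, n⟩) y ⟨hy, hy'⟩
    · exact ⟨hy, fun h => hy' (mem_iUnion.2 ⟨⟨y, h⟩, hbV _ _⟩)⟩
    · refine ⟨(hVb b n y hy).1, fun h => hy' ?_⟩
      rw [huniq b ⟨y, h⟩ n 0 y hy (hbV _ _)]
      exact hbV ⟨y, h⟩ _
  have hAdisj : ∀ i j y, y ∈ A i → y ∈ A j → i = j := by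
    rintro (_ | ⟨b, n⟩) (_ | ⟨c, k⟩) y ⟨hi, hi'⟩ ⟨hj, hj'⟩
    · rfl
    · exact absurd (mem_iUnion.2 ⟨c, hanti c (Nat.zero_le k) hj⟩) hi'
    · exact absurd (mem_iUnion.2 ⟨b, hanti b (Nat.zero_le n) hi⟩) hj'
    · obtain rfl := huniq b c n k y hi hj
      have h₁ : ¬ n + 1 ≤ k := fun h => hi' (hanti b h hj)
      have h₂ : ¬ k + 1 ≤ n := fun h => hj' (hanti b h hi)
      rw [show n = k by omega]
  have hAcov : ∀ y ∈ U \ B, ∃ i, y ∈ A i := by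
    rintro y ⟨hy, hyB⟩
    by_cases h : ∃ b, y ∈ V b 0
    · obtain ⟨b, hb⟩ := h
      have hex : ∃ n, y ∉ V b n := by
        obtain ⟨n, hn⟩ := hbase b {y}ᶜ isOpen_compl_singleton fun h => hyB (h ▸ b.2)
        exact ⟨n, fun h => hn h rfl⟩
      obtain ⟨n, hn⟩ : ∃ n, Nat.find hex = n + 1 :=
        Nat.exists_eq_succ_of_ne_zero fun h0 => Nat.find_spec hex (h0 ▸ hb)
      refine ⟨some (b, n), not_not.1 (Nat.find_min hex (m := n) (by omega)), ?_⟩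
      have := Nat.find_spec hex
      rwa [hn] at this
    · exact ⟨none, hy, fun h' => h (mem_iUnion.1 h')⟩
  choose! idx hidx using hAcov
  have hC : ∀ i, ∀ z ∈ A i, idx z = i := fun i z hz =>
    hAdisj _ _ z (hidx z (hAU i hz)) hz
  -- The `n`-th annulus gets `g n`; for the remainder any value of `g` would do.
  let val : Option (B × ℕ) → W := fun i => i.elim (g 0) fun p => g p.2
  refine ⟨B, fun y => A (idx y), fun y => val (idx y), hBU, hdns, fun b hb => ?_,
    fun y hy => ⟨hAcl _, hidx y hy, hAU _, ?_, fun z hz => ?_⟩, fun b hb O hO hbO => ?_⟩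
  · refine ⟨Metric.ball b ε, Metric.isOpen_ball, Metric.mem_ball_self hε, ?_⟩
    rintro c ⟨hc, hcB⟩
    exact hsep c hcB b hb hc
  · rcases h : idx y with _ | p
    exacts [⟨0, by simp [h, val]⟩, ⟨p.2, by simp [h, val]⟩]
  · simp only [hC _ z hz, and_self]
  · obtain ⟨N, hN⟩ := hbase ⟨b, hb⟩ O hO hbO
    refine ⟨N, fun k hk => ?_⟩
    obtain ⟨y, hy⟩ := hne ⟨b, hb⟩ k
    have hyA : y ∈ A (some (⟨b, hb⟩, k)) := hy
    refine ⟨y, hAU _ hyA, ?_, ?_⟩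
    · simp only [hC _ y hyA]
      exact sdiff_subset.trans ((hanti ⟨b, hb⟩ hk).trans hN)
    · simp only [hC _ y hyA]
      rfl

/-- A noncompact 0-dimensional metric space has a partition into infinitely many clopen sets. -/
theorem exists_clopen_partition (hzero : ZeroDimensional X) (hnc : ¬ CompactSpace X) :
    ∃ c : X → ℕ, Function.Surjective c ∧ ∀ n, IsClopen (c ⁻¹' {n}) := by
  classical
  -- Noncompactness of a metric space gives a sequence without cluster points.
  have h₁ : ∃ u : ℕ → X, ∀ x, ∃ s ∈ 𝓝 x, {n | u n ∈ s}.Finite := by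
    by_contra! h
    refine hnc (compactSpace_iff_seqCompactSpace.2 ⟨fun u _ => ?_⟩)
    obtain ⟨x, hx⟩ := h u
    have : MapClusterPt x Filter.atTop u := by
      refine mapClusterPt_iff_frequently.2 fun s hs => ?_
      exact Nat.frequently_atTop_iff_infinite.2 (hx s hs)
    obtain ⟨φ, hφ, hlim⟩ := this.tendsto_subseq
    exact ⟨x, mem_univ _, φ, hφ, hlim⟩
  obtain ⟨u, hu⟩ := h₁
  have hinf : (range u).Infinite := by
    intro hfin
    have := hfin.to_subtype
    obtain ⟨⟨_, m, rfl⟩, hy⟩ := Finite.exists_infinite_fiber (rangeFactorization u)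
    obtain ⟨s, hs, hsf⟩ := hu (u m)
    refine (infinite_coe_iff.1 hy) (hsf.subset fun n hn => ?_)
    have : u n = u m := congrArg Subtype.val hn
    simpa [this] using mem_of_mem_nhds hs
  let e : ℕ ↪ range u := hinf.natEmbedding
  let a : ℕ → X := fun n => (e n).1
  have hainj : Function.Injective a := Subtype.val_injective.comp e.injective
  have ha : ∀ x, ∃ s ∈ 𝓝 x, {n | a n ∈ s}.Finite := by
    intro x
    obtain ⟨s, hs, hf⟩ := hu x
    refine ⟨s, hs, ((hf.image u).preimage hainj.injOn).subset fun n hn => ?_⟩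
    obtain ⟨k, hk⟩ := (e n).2
    exact ⟨k, by simpa [hk] using hn, hk⟩
  -- The shrinking radii make the family locally finite, hence its union clopen.
  have hV : ∀ n, ∃ V : Set X, IsClopen V ∧ a n ∈ V ∧
      V ⊆ Metric.ball (a n) (1 / ((n : ℝ) + 1)) ∧ ∀ m, a m ∈ V → m = n := by
    intro n
    obtain ⟨s, hs, hf⟩ := ha (a n)
    have hcl : IsClosed (a '' ({m | a m ∈ s} \ {n})) := (hf.sdiff.image a).isClosed
    obtain ⟨V, hVc, hV, hVs⟩ := hzero.exists_clopen_subset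
      (O := Metric.ball (a n) (1 / ((n : ℝ) + 1)) ∩ interior s ∩ (a '' ({m | a m ∈ s} \ {n}))ᶜ)
      ((Metric.isOpen_ball.inter isOpen_interior).inter hcl.isOpen_compl)
      ⟨⟨Metric.mem_ball_self (by positivity), mem_interior_iff_mem_nhds.2 hs⟩, by
        rintro ⟨m, ⟨-, hm⟩, h⟩
        exact hm (hainj h)⟩
    refine ⟨V, hVc, hV, fun x hx => (hVs hx).1.1, fun m hm => ?_⟩
    by_contra hne
    exact (hVs hm).2 ⟨m, ⟨interior_subset (s := s) (hVs hm).1.2, hne⟩, rfl⟩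
  choose V hVcl haV hVball hVa using hV
  have hVfin : LocallyFinite V := by
    intro x
    obtain ⟨s, hs, hf⟩ := ha x
    obtain ⟨δ, hδ, hδs⟩ := Metric.mem_nhds_iff.1 hs
    obtain ⟨N, hN⟩ := exists_nat_one_div_lt (half_pos hδ)
    refine ⟨Metric.ball x (δ / 2), Metric.ball_mem_nhds x (half_pos hδ),
      (hf.union (finite_Iio N)).subset ?_⟩
    rintro n ⟨y, hy, hyx⟩
    by_cases hn : n < N
    · exact .inr hn
    · left
      refine hδs ?_
      have h₁ := Metric.mem_ball.1 (hVball n hy)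
      have h₂ := Metric.mem_ball.1 hyx
      have h₃ : 1 / ((n : ℝ) + 1) ≤ 1 / ((N : ℝ) + 1) :=
        Nat.one_div_le_one_div (not_lt.1 hn)
      rw [Metric.mem_ball]
      linarith [dist_triangle_left (a n) x y]
  have hUnion : IsClopen (⋃ n, V n) :=
    ⟨hVfin.isClosed_iUnion fun n => (hVcl n).isClosed, isOpen_iUnion fun n => (hVcl n).isOpen⟩
  -- Adding the leftover part makes the sets cover X; taking the least index then makes them
  -- disjoint. The point `a n` lies in `V' n` only, so every index occurs.
  let V' : ℕ → Set X := fun n => V n ∪ (⋃ n, V n)ᶜ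
  have hV'cl : ∀ n, IsClopen (V' n) := fun n => (hVcl n).union hUnion.compl
  have hcov : ∀ x, ∃ n, x ∈ V' n := by
    intro x
    by_cases h : ∃ n, x ∈ V n
    · exact h.imp fun n hn => .inl hn
    · exact ⟨0, .inr fun h' => h (mem_iUnion.1 h')⟩
  refine ⟨fun x => Nat.find (hcov x), fun n => ⟨a n, ?_⟩, fun n => ?_⟩
  · refine (Nat.find_eq_iff _).2 ⟨.inl (haV n), fun m hm h => ?_⟩
    rcases h with h | h
    · exact hm.ne (hVa m n h).symm
    · exact h (mem_iUnion.2 ⟨n, haV n⟩)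
  · have : (fun x => Nat.find (hcov x)) ⁻¹' {n} = V' n ∩ ⋂ m ∈ Finset.range n, (V' m)ᶜ := by
      ext x
      simp [Nat.find_eq_iff]
    rw [this]
    exact (hV'cl n).inter (isClopen_biInter_finset fun m _ => (hV'cl m).compl)

end ZeroDimensional

/-! ### Labelling the space by a transitive frame -/

section Labelling

variable {X : Type*} [MetricSpace X]

/-- A 0-dimensional dense-in-itself metric space can be labelled by the points of a transitive
frame with limits of chains. At every point `x`, either (1) the nearby points have labels related
to that of `x`, and the chosen successors `g (f x) k` of its label occur near `x`; or (2) the label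
is the limit of a chain `w` and the same holds with the labels `w n` in place of `f x`. -/
theorem exists_labelling (hzero : ZeroDimensional X) (hdense : DenseInItself X) {W : Type*}
    {R : W → W → Prop} (hR : ∀ {u v w}, R u v → R v w → R u w) (g : W → ℕ → W)
    (hg : ∀ w n, R w (g w n)) (lim : (ℕ → W) → W)
    (hlim : ∀ w : ℕ → W, (∀ n, R (w n) (w (n + 1))) → ∀ n, R (w n) (lim w))
    (c : X → ℕ) (hc : ∀ n, IsClopen (c ⁻¹' {n})) (σ : ℕ → W) :
    ∃ f : X → W, (∀ x, ∃ y, f y = σ (c x)) ∧ (∀ x, ∃ n, f x = σ n ∨ R (σ n) (f x)) ∧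
      ∀ x,
        ((∃ O : Set X, IsOpen O ∧ x ∈ O ∧ ∀ y ∈ O, y ≠ x → R (f x) (f y)) ∧
          ∀ O : Set X, IsOpen O → x ∈ O →
            ∃ N, ∀ k ≥ N, ∃ y ∈ O, y ≠ x ∧ f y = g (f x) k) ∨
        ∃ w : ℕ → W, (∀ n, R (w n) (w (n + 1))) ∧ f x = lim w ∧
          (∀ n, ∃ O : Set X, IsOpen O ∧ x ∈ O ∧ ∀ y ∈ O, R (w n) (f y)) ∧
          ∀ O : Set X, IsOpen O → x ∈ O →
            ∃ n N, ∀ k ≥ N, ∃ y ∈ O, y ≠ x ∧ f y = g (w n) k := by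
  classical
  have hstep : ∀ (U : {U : Set X // IsClopen U}) (w : W) (n : ℕ), _ := fun U w n =>
    exists_cells hzero hdense (g w) U.2 (ε := 1 / ((n : ℝ) + 1)) (by positivity)
  choose B C lab hBU hdns hdisc hcell hconv using hstep
  -- A state is a cell with its label. Points selected into `B` stay put; the others pass to their
  -- subcell.
  let next : {U : Set X // IsClopen U} × W → ℕ → X → {U : Set X // IsClopen U} × W :=
    fun s n x => if h : x ∈ s.1.1 \ B s.1 s.2 n then
      (⟨C s.1 s.2 n x, (hcell s.1 s.2 n x h).1⟩, lab s.1 s.2 n x) else s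
  let st : ℕ → X → {U : Set X // IsClopen U} × W := fun n x =>
    Nat.rec (⟨c ⁻¹' {c x}, hc _⟩, σ (c x)) (fun n s => next s n x) n
  let sel : ℕ → X → Prop := fun n x => x ∈ B (st n x).1 (st n x).2 n
  have hsucc : ∀ n x, st (n + 1) x = next (st n x) n x := fun _ _ => rfl
  have hmem : ∀ n x, x ∈ (st n x).1.1 := by
    intro n x
    induction n with
    | zero => exact rfl
    | succ n ih =>
      rw [hsucc]
      simp only [next]
      split_ifs with h
      · exact (hcell _ _ _ x h).2.1
      · exact ih
  have hnext : ∀ n x, ¬ sel n x → ∃ h : x ∈ (st n x).1.1 \ B (st n x).1 (st n x).2 n,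
      st (n + 1) x = (⟨C (st n x).1 (st n x).2 n x, (hcell _ _ _ x h).1⟩,
        lab (st n x).1 (st n x).2 n x) := by
    intro n x h
    have h' : x ∈ (st n x).1.1 \ B (st n x).1 (st n x).2 n := ⟨hmem n x, h⟩
    exact ⟨h', by rw [hsucc]; exact dif_pos h'⟩
  -- All points of the current cell of an unselected point have reached the same state, also
  -- unselected.
  have hcoh : ∀ n x, (∀ i < n, ¬ sel i x) → ∀ y ∈ (st n x).1.1,
      st n y = st n x ∧ ∀ i < n, ¬ sel i y := by
    intro n
    induction n with
    | zero =>
      intro x _ y hy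
      have : c y = c x := hy
      refine ⟨?_, by simp⟩
      simp only [st, this]
      rfl
    | succ n ih =>
      intro x hx y hy
      obtain ⟨h, e⟩ := hnext n x (hx n (by omega))
      rw [e] at hy
      obtain ⟨-, -, hsub, -, hsame⟩ := hcell _ _ _ x h
      obtain ⟨e₁, hy₁⟩ := ih x (fun i hi => hx i (by omega)) y (hsub hy).1
      have hsy : ¬ sel n y := by
        simp only [sel, e₁]
        exact (hsub hy).2
      obtain ⟨h', e'⟩ := hnext n y hsy
      refine ⟨?_, fun i hi => ?_⟩
      · rw [e, e']
        refine Prod.ext (Subtype.ext ?_) ?_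
        · simp only [e₁]
          exact (hsame y hy).1
        · simp only [e₁]
          exact (hsame y hy).2
      · rcases Nat.lt_succ_iff_lt_or_eq.1 hi with hi | rfl
        exacts [hy₁ i hi, hsy]
  have hRsucc : ∀ n x, ¬ sel n x → R (st n x).2 (st (n + 1) x).2 := by
    intro n x hx
    obtain ⟨h, e⟩ := hnext n x hx
    rw [e]
    obtain ⟨-, -, -, ⟨k, hk⟩, -⟩ := hcell _ _ _ x h
    simp only [hk]
    exact hg _ _
  have hRlt : ∀ n x k, n < k → (∀ i < k, ¬ sel i x) → R (st n x).2 (st k x).2 := by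
    intro n x k hk
    induction k, hk using Nat.le_induction with
    | base => exact fun h => hRsucc n x (h n (by omega))
    | succ k _ ih =>
      exact fun h => hR (ih fun i hi => h i (by omega)) (hRsucc k x (h k (by omega)))
  let f : X → W := fun x => if h : ∃ n, sel n x then (st (Nat.find h) x).2 else
    lim fun n => (st n x).2
  have hfsel : ∀ n x, (∀ i < n, ¬ sel i x) → sel n x → f x = (st n x).2 := by
    intro n x hx hs
    have hex : ∃ n, sel n x := ⟨n, hs⟩
    have : Nat.find hex = n := (Nat.find_eq_iff hex).2 ⟨hs, hx⟩
    simp only [f, dif_pos hex, this]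
  have hflim : ∀ x, (∀ n, ¬ sel n x) → f x = lim fun n => (st n x).2 := by
    intro x hx
    exact dif_neg (not_exists.2 hx)
  have hfR : ∀ n x, (∀ i < n + 1, ¬ sel i x) → R (st n x).2 (f x) := by
    intro n x hx
    by_cases hex : ∃ k, sel k x
    · have hk : n < Nat.find hex := by
        by_contra hle
        exact hx _ (by omega) (Nat.find_spec hex)
      have hmin : ∀ i < Nat.find hex, ¬ sel i x := fun i hi => Nat.find_min hex hi
      rw [hfsel _ x hmin (Nat.find_spec hex)]
      exact hRlt n x _ hk hmin
    · have hall := not_exists.1 hex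
      rw [hflim x hall]
      exact hlim _ (fun k => hRsucc k x (hall k)) n
  -- Each cell's label is realised exactly, by the points selected in it at that stage.
  have hselnear : ∀ n x, (∀ i < n, ¬ sel i x) → ∃ b ∈ (st n x).1.1, (∀ i < n, ¬ sel i b) ∧
      sel n b ∧ st n b = st n x ∧ f b = (st n x).2 ∧ dist x b < 1 / ((n : ℝ) + 1) := by
    intro n x hx
    obtain ⟨b, hb, hd⟩ := hdns (st n x).1 (st n x).2 n x (hmem n x)
    have hbU := hBU _ _ _ hb
    obtain ⟨e, hb'⟩ := hcoh n x hx b hbU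
    have hsb : sel n b := by
      simp only [sel, e]
      exact hb
    exact ⟨b, hbU, hb', hsb, e, by rw [hfsel n b hb' hsb, e], hd⟩
  have hselconv : ∀ n x, (∀ i < n, ¬ sel i x) → sel n x → ∀ O : Set X, IsOpen O → x ∈ O →
      ∃ N, ∀ k ≥ N, ∃ y ∈ O, y ≠ x ∧ f y = g (st n x).2 k := by
    intro n x hx hs O hO hxO
    obtain ⟨N, hN⟩ := hconv _ _ _ x hs O hO hxO
    refine ⟨N, fun k hk => ?_⟩
    obtain ⟨y, hy, hyO, hyl⟩ := hN k hk
    obtain ⟨e, hy'⟩ := hcoh n x hx y hy.1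
    have hsy : ¬ sel n y := by
      simp only [sel, e]
      exact hy.2
    have hy'' : ∀ i < n + 1, ¬ sel i y := fun i hi => by
      rcases Nat.lt_succ_iff_lt_or_eq.1 hi with hi | rfl
      exacts [hy' i hi, hsy]
    obtain ⟨h, e'⟩ := hnext n y hsy
    -- The subcell of `y` only promises the label `g _ k`; a point selected in it at the next stage
    -- has it.
    obtain ⟨b, hb, -, -, -, hfb, -⟩ := hselnear (n + 1) y hy''
    rw [e'] at hb hfb
    simp only [e] at hb hfb
    refine ⟨b, hyO hb, ?_, hfb.trans hyl⟩
    rintro rfl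
    exact ((hcell _ _ _ y hy).2.2.1 hb).2 hs
  refine ⟨f, fun x => ?_, fun x => ?_, fun x => ?_⟩
  · obtain ⟨b, -, -, -, -, hb, -⟩ := hselnear 0 x (by simp)
    exact ⟨b, hb⟩
  · refine ⟨c x, ?_⟩
    by_cases hs : sel 0 x
    · exact .inl (hfsel 0 x (by simp) hs)
    · exact .inr (hfR 0 x (by simpa using hs))
  · by_cases hex : ∃ n, sel n x
    · left
      have hs := Nat.find_spec hex
      have hmin : ∀ i < Nat.find hex, ¬ sel i x := fun i hi => Nat.find_min hex hi
      generalize Nat.find hex = n at hs hmin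
      rw [hfsel n x hmin hs]
      refine ⟨?_, hselconv n x hmin hs⟩
      -- Discreteness of `B` leaves only unselected points near `x`, whose labels move on along `R`.
      obtain ⟨O, hO, hxO, hOB⟩ := hdisc _ _ _ x hs
      refine ⟨O ∩ (st n x).1.1, hO.inter (st n x).1.2.isOpen, ⟨hxO, hmem n x⟩, ?_⟩
      rintro y ⟨hyO, hyU⟩ hne
      obtain ⟨e, hy'⟩ := hcoh n x hmin y hyU
      have hsy : ¬ sel n y := by
        simp only [sel, e]
        exact fun h => hne (hOB ⟨hyO, h⟩)
      rw [← e]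
      refine hfR n y fun i hi => ?_
      rcases Nat.lt_succ_iff_lt_or_eq.1 hi with hi | rfl
      exacts [hy' i hi, hsy]
    · right
      have hall := not_exists.1 hex
      refine ⟨fun n => (st n x).2, fun n => hRsucc n x (hall n), hflim x hall, fun n => ?_,
        fun O hO hxO => ?_⟩
      -- Stage `n + 1` is needed: its points have all left the label of stage `n` by at least one
      -- `R`-step.
      · refine ⟨_, (st (n + 1) x).1.2.isOpen, hmem (n + 1) x, fun y hy => ?_⟩
        obtain ⟨-, hy'⟩ := hcoh (n + 1) x (fun i _ => hall i) y hy
        obtain ⟨hx, hcx⟩ := hnext n x (hall n)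
        rw [hcx] at hy
        obtain ⟨e, -⟩ := hcoh n x (fun i _ => hall i) y
          ((hcell _ _ _ x hx).2.2.1 hy).1
        beta_reduce
        rw [← e]
        exact hfR n y hy'
      · obtain ⟨ε, hε, hb⟩ := Metric.isOpen_iff.1 hO x hxO
        obtain ⟨n, hn⟩ := exists_nat_one_div_lt hε
        obtain ⟨b, -, hb', hsb, e, -, hd⟩ := hselnear n x fun i _ => hall i
        have hbx : b ≠ x := fun h => hall n (h ▸ hsb)
        have hbO : b ∈ O := hb (by rw [Metric.mem_ball, dist_comm]; linarith)
        obtain ⟨N, hN⟩ := hselconv n b hb' hsb (O ∩ {x}ᶜ) (hO.inter isOpen_compl_singleton)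
          ⟨hbO, hbx⟩
        refine ⟨n, N, fun k hk => ?_⟩
        obtain ⟨y, ⟨hyO, hyx⟩, -, hfy⟩ := hN k hk
        exact ⟨y, hyO, hyx, by rw [hfy, e]⟩

end Labelling

end TopModal

namespace TopModal

open Topology TopologicalSpace Set

/-! ### Soundness -/

section Soundness

variable {m : LocalModality} {Var : Type*} {X : Type*} [TopologicalSpace X]

theorem sat_iff_propEval (h : Var → Set X) (x : X) (φ : Formula m Var) :
    Formula.propEval (fun ψ => Sat h x ψ) φ ↔ Sat h x φ := by
  induction φ with
  | var => rfl
  | top => simp [Formula.propEval, Sat]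
  | neg φ ih => simp [Formula.propEval, Sat, ih]
  | and φ ψ ih₁ ih₂ => simp [Formula.propEval, Sat, ih₁, ih₂]
  | box => rfl
  | all => rfl

theorem sat_imp (h : Var → Set X) (x : X) (φ ψ : Formula m Var) :
    Sat h x (φ.imp ψ) ↔ (Sat h x φ → Sat h x ψ) := by
  simp [Formula.imp, Sat]

theorem LocalModality.scope_subset {X : Type*} (m : LocalModality) (O : Set X) (x : X) : m.scope O x ⊆ O := by
  cases m
  exacts [subset_rfl, sdiff_subset]

theorem LocalModality.scope_mono {X : Type*} (m : LocalModality) {O O' : Set X} (h : O ⊆ O') (x : X) :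
    m.scope O x ⊆ m.scope O' x := by
  cases m
  exacts [h, sdiff_subset_sdiff_left h]

theorem LocalModality.isOpen_scope [T1Space X] (m : LocalModality) {O : Set X} (h : IsOpen O)
    (x : X) : IsOpen (m.scope O x) := by
  cases m
  exacts [h, h.sdiff isClosed_singleton]

theorem sat_box_K (h : Var → Set X) (x : X) (φ ψ : Formula m Var) :
    Sat h x (((φ.imp ψ).box).imp (φ.box.imp ψ.box)) := by
  simp only [sat_imp, Sat]
  rintro ⟨O, hO, hx, h₁⟩ ⟨O', hO', hx', h₂⟩
  exact ⟨O ∩ O', hO.inter hO', ⟨hx, hx'⟩, fun y hy =>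
    h₁ y (m.scope_mono inter_subset_left x hy) (h₂ y (m.scope_mono inter_subset_right x hy))⟩

/-- In a T1 space the punctured neighbourhood is open, so it serves as neighbourhood of each of its
points. -/
theorem sat_box_4 [T1Space X] (h : Var → Set X) (x : X) (φ : Formula m Var) :
    Sat h x (φ.box.imp φ.box.box) := by
  simp only [sat_imp, Sat]
  rintro ⟨O, hO, hx, h₁⟩
  exact ⟨O, hO, hx, fun y hy => ⟨m.scope O x, m.isOpen_scope hO x, hy,
    fun z hz => h₁ z (m.scope_subset _ _ hz)⟩⟩

theorem sat_all_box (h : Var → Set X) (x : X) (φ : Formula m Var) :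
    Sat h x (φ.all.imp φ.box) := by
  simp only [sat_imp, Sat]
  exact fun h => ⟨univ, isOpen_univ, mem_univ x, fun y _ => h y⟩

theorem entails_empty {φ : Formula m Var} (h : ∀ (h : Var → Set X) (x : X), Sat h x φ) :
    Entails X ∅ φ := by
  rintro ⟨v, x, hx⟩
  exact hx φ.neg (by simp) (h v x)

theorem KD4U.soundOver [T1Space X] (hX : DenseInItself X) :
    SoundOver (KD4U (Var := Var)) X := by
  intro φ hφ
  refine entails_empty fun h => ?_
  induction hφ with
  | taut ht => exact fun x => (sat_iff_propEval h x _).1 (ht _)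
  | box_K φ ψ => exact fun x => sat_box_K h x φ ψ
  | box_D =>
    rintro x ⟨O, hO, hx, h₁⟩
    have : O = {x} := by
      refine Subset.antisymm (fun y hy => ?_) (singleton_subset_iff.2 hx)
      by_contra hne
      exact h₁ y ⟨hy, hne⟩ trivial
    exact hX x (this ▸ hO)
  | box_4 φ => exact fun x => sat_box_4 h x φ
  | all_box φ => exact fun x => sat_all_box h x φ
  | modus_ponens _ _ ih₁ ih₂ => exact fun x => (sat_imp h x _ _).1 (ih₁ x) (ih₂ x)
  | univ_gen _ ih => exact fun x y => ih y
  | all_K | all_T | all_B | all_4 =>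
    intro x
    simp only [sat_imp, Sat, Formula.ex]
    grind

theorem S4U.soundOver [T1Space X] : SoundOver (S4U (Var := Var)) X := by
  intro φ hφ
  refine entails_empty fun h => ?_
  induction hφ with
  | taut ht => exact fun x => (sat_iff_propEval h x _).1 (ht _)
  | box_K φ ψ => exact fun x => sat_box_K h x φ ψ
  | box_T φ => exact fun x => (sat_imp h x _ _).2 fun ⟨O, _, hx, h₁⟩ => h₁ x hx
  | box_4 φ => exact fun x => sat_box_4 h x φ
  | all_box φ => exact fun x => sat_all_box h x φ
  | modus_ponens _ _ ih₁ ih₂ => exact fun x => (sat_imp h x _ _).1 (ih₁ x) (ih₂ x)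
  | univ_gen _ ih => exact fun x y => ih y
  | all_K | all_T | all_B | all_4 =>
    intro x
    simp only [sat_imp, Sat, Formula.ex]
    grind

end Soundness

/-! ### The truth lemma and strong completeness -/

section Completeness

variable {m : LocalModality} {Var : Type*} [Countable Var] {L : Formula m Var → Prop}
  {X : Type*} [MetricSpace X]

theorem World.SameAll.exists_seq (hL : IsLogic L) (w₀ : World L) :
    ∃ σ : ℕ → World L, σ 0 = w₀ ∧ (∀ n, World.SameAll w₀ (σ n)) ∧
      ∀ φ : Formula m Var, φ.all ∉ w₀ → ∃ n, φ ∉ σ n := by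
  have : Nonempty (Formula m Var) := ⟨.top⟩
  obtain ⟨e, he⟩ := exists_surjective_nat (Formula m Var)
  have : ∀ n, ∃ v : World L, World.SameAll w₀ v ∧ ((e n).all ∉ w₀ → e n ∉ v) := by
    intro n
    by_cases h : (e n).all ∈ w₀
    · exact ⟨w₀, fun _ => Iff.rfl, fun h' => absurd h h'⟩
    · obtain ⟨v, hv, hφ⟩ := w₀.exists_sameAll hL h
      exact ⟨v, hv, fun _ => hφ⟩
  choose τ hτ hτ' using this
  refine ⟨fun n => n.casesOn w₀ τ, rfl, fun n => ?_, fun φ hφ => ?_⟩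
  · cases n
    exacts [fun _ => Iff.rfl, hτ _]
  · obtain ⟨n, rfl⟩ := he φ
    exact ⟨n + 1, hτ' n hφ⟩

theorem IsLogic.stronglyCompleteOver (hL : IsLogic L) (hnoncompact : ¬ CompactSpace X)
    (hzero : ZeroDimensional X) (hdense : DenseInItself X) : StronglyCompleteOver L X := by
  intro Γ φ₀ hent
  by_contra hnot
  refine hent ?_
  obtain ⟨w₀, hw₀⟩ := hL.exists_world (hL.consistent_insert_neg hnot)
  obtain ⟨σ, hσ₀, hσ, hσ'⟩ := World.SameAll.exists_seq hL w₀
  obtain ⟨c, hcsurj, hc⟩ := exists_clopen_partition hzero hnoncompact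
  choose g hg hg' using fun w : World L => w.exists_rel_seq hL
  have hlim : ∀ w : ℕ → World L, ∃ u : World L, (∀ n, World.Rel (w n) (w (n + 1))) →
      (∀ n, World.Rel (w n) u) ∧ ∀ φ : Formula m Var, φ.box ∈ u → ∃ n, φ.box ∈ w n := by
    intro w
    by_cases h : ∀ n, World.Rel (w n) (w (n + 1))
    · exact (World.exists_limit hL w h).imp fun u hu _ => hu
    -- Off chains the value of `lim` is irrelevant.
    · exact ⟨w 0, fun h' => absurd h' h⟩
  choose lim hlim using hlim
  obtain ⟨f, hf₁, hf₂, hf₃⟩ := exists_labelling hzero hdense (R := World.Rel (L := L))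
    (fun h₁ h₂ => h₁.trans hL h₂) g hg lim (fun w hw => (hlim w hw).1) c hc σ
  have hsame : ∀ x, World.SameAll w₀ (f x) := by
    intro x
    obtain ⟨n, hn | hn⟩ := hf₂ x
    · exact hn ▸ hσ n
    · exact fun φ => (hσ n φ).trans (hn.sameAll hL φ)
  have hσf : ∀ n, ∃ x, f x = σ n := fun n =>
    let ⟨x, hx⟩ := hcsurj n
    hx ▸ hf₁ x
  have hscope : ∀ {O : Set X} {x y : X}, y ∈ O → y ≠ x → y ∈ m.scope O x := by
    intro O x y hy hne
    cases m
    exacts [hy, ⟨hy, hne⟩]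
  have truth : ∀ (φ : Formula m Var) (x : X),
      Sat (fun p => {x | Formula.var p ∈ f x}) x φ ↔ φ ∈ f x := by
    intro φ
    induction φ with
    | var p => exact fun x => Iff.rfl
    | top => exact fun x => iff_of_true trivial ((f x).mem_top hL)
    | neg φ ih => exact fun x => by rw [(f x).mem_neg hL, ← ih]; rfl
    | and φ ψ ih₁ ih₂ => exact fun x => by rw [(f x).mem_and hL, ← ih₁, ← ih₂]; rfl
    | all φ ih =>
      intro x
      refine ⟨fun h => ?_, fun h y => (ih y).2 ?_⟩
      · by_contra h'
        obtain ⟨n, hn⟩ := hσ' φ fun h₀ => h' ((hsame x φ).1 h₀)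
        obtain ⟨y, hy⟩ := hσf n
        exact hn (hy ▸ (ih y).1 (h y))
      · exact (f y).mp hL (hL.all_T φ) ((hsame y φ).1 ((hsame x φ).2 h))
    | box φ ih =>
      intro x
      constructor
      · rintro ⟨O, hO, hx, h⟩
        by_contra h'
        -- Witnesses against `φ` recur infinitely often in `g w`, so one of them appears in the tail
        -- realised inside `O`.
        have key : ∀ w : World L, φ.box ∉ w → (∃ N, ∀ k ≥ N, ∃ y ∈ O, y ≠ x ∧ f y = g w k) →
            False := by
          rintro w hw ⟨N, hN⟩
          obtain ⟨k, hk, hφ⟩ := hg' w φ hw N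
          obtain ⟨y, hy, hne, hfy⟩ := hN k hk
          exact hφ (hfy ▸ (ih y).1 (h y (hscope hy hne)))
        rcases hf₃ x with ⟨-, hd⟩ | ⟨w, hw, hfx, -, hd⟩
        · exact key _ h' (hd O hO hx)
        · obtain ⟨n, hn⟩ := hd O hO hx
          -- Boxes persist along `Rel`, so a box missing from the limit is missing from every `w n`.
          exact key (w n) (fun hb => h' (hfx ▸ ((hlim w hw).1 n).box_mem hL hb)) hn
      · intro h
        rcases hf₃ x with ⟨⟨O, hO, hx, hR⟩, -⟩ | ⟨w, hw, hfx, hU, -⟩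
        · refine ⟨O, hO, hx, fun y hy => (ih y).2 ?_⟩
          -- Only here do the modalities differ: `□` also looks at `x` and needs T, while `[d]`
          -- excludes it.
          by_cases hne : y = x
          · subst hne
            cases m with
            | interior => exact (f y).mp hL (hL.box_T φ rfl) h
            | coderivative => exact absurd rfl hy.2
          · exact hR y (m.scope_subset O x hy) hne φ h
        · obtain ⟨n, hn⟩ := (hlim w hw).2 φ (hfx ▸ h)
          obtain ⟨O, hO, hx, hR⟩ := hU n
          exact ⟨O, hO, hx, fun y hy => (ih y).2 (hR y (m.scope_subset O x hy) φ hn)⟩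
  obtain ⟨x, hx⟩ := hσf 0
  refine ⟨_, x, fun γ hγ => (truth γ x).2 ?_⟩
  rw [hx, hσ₀]
  refine hw₀ ?_
  rcases hγ with h | h
  exacts [.inr h, .inl h]

end Completeness

end TopModal

theorem mainTheorem2 (Var : Type*) [Countable Var] [Infinite Var]
    (X : Type*) [MetricSpace X] (hnoncompact : ¬ CompactSpace X)
    (hzero : TopModal.ZeroDimensional X) (hdense : TopModal.DenseInItself X) :
    (TopModal.SoundOver (TopModal.KD4U (Var := Var)) X ∧
      TopModal.StronglyCompleteOver (TopModal.KD4U (Var := Var)) X) ∧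
    (TopModal.SoundOver (TopModal.S4U (Var := Var)) X ∧
      TopModal.StronglyCompleteOver (TopModal.S4U (Var := Var)) X) :=
  ⟨⟨TopModal.KD4U.soundOver hdense,
      TopModal.KD4U.isLogic.stronglyCompleteOver hnoncompact hzero hdense⟩,
    TopModal.S4U.soundOver,
    TopModal.S4U.isLogic.stronglyCompleteOver hnoncompact hzero hdense⟩
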